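/- Let $M\ge 2$ and let $s_1,\dots,s_M:\mathbb{R}^n\to\mathbb{R}^n$ be contracting similarities, $|s_i(x)-s_i(y)|=\rho_i|x-y|$ with $\rho_i\in(0,1)$, satisfying the open set condition: there is a non-empty bounded open set $O\subset\mathbb{R}^n$ with $s_i(O)\subset O$ for all $i$ and $s_i(O)\cap s_j(O)=\emptyset$ for $i\ne j$. Let $\Gamma$ be the attractor, i.e. the unique non-empty compact set with $\Gamma=\bigcup_{i=1}^M s_i(\Gamma)$. Let $\mu$ and $\mu'$ be self-similar measures on $\Gamma$ with weights $(p_i)$ and $(p'_i)$, that is, $0<p_i<1$, $\sum_i p_i=1$, and $\mu$ is a non-zero finite Borel measure supported on $\Gamma$ such that $\mu(E)=\sum_{i} p_i\,\mu(s_i^{-1}(E))$ for all measurable $E$; similarly for $\mu'$ and $(p_i')$. For a finite (possibly empty) sequence $\mathbf{m}=(m_1,\dots,m_\ell)$ in $\{1,\dots,M\}$ put $s_{\mathbf{m}}=s_{m_1}\circ\cdots\circ s_{m_\ell}$, $\Gamma_{\mathbf{m}}=s_{\mathbf{m}}(\Gamma)$, $p_{\mathbf{m}}=\prod_{i=1}^{\ell}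 p_{m_i}$ and $p'_{\mathbf{m}}=\prod_{i=1}^{\ell} p'_{m_i}$, with $s_\emptyset=\mathrm{id}$ and $p_\emptyset=p'_\emptyset=1$. Let $\Phi_t(x,y)=|x-y|^{-t}$ for $t>0$ and $\Phi_0(x,y)=\log|x-y|$, and define, for $t\geq 0$, $$I_{\mathbf{m},\mathbf{m}'}=\int_{\Gamma_{\mathbf{m}}}\int_{\Gamma_{\mathbf{m}'}}\Phi_t(x,y)\,\mathrm{d}\mu'(y)\,\mathrm{d}\mu(x).$$ Let $t_*$ be the largest number such that $I_{\emptyset,\emptyset}$ converges (absolutely) for all $0\le t<t_*$, and assume that such a positive number exists, so that $t_*>0$. Let $\mathbf{m},\mathbf{m}',\mathbf{n},\mathbf{n}'$ be finite (possibly empty) sequences in $\{1,\dots,M\}$, and let $T,T'$ be isometries of $\mathbb{R}^n$ such that $\mu$ and $\mu'$ are invariant under $T$ and $T'$ respectively, i.e. $\mu(T(E))=\mu(E)$ and $\mu'(T'(E))=\mu'(E)$ for all measurable $E$. Suppose that there exists $\varrho>0$ such that $$|s_{\mathbf{m}}(T(s_{\mathbf{n}}^{-1}(x)))-s_{\mathbf{m}'}(T'(s_{\mathbf{n}'}^{-1}(y)))|=\varrho\,|x-y|\qquad\text{for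 all }x,y\in\mathbb{R}^n.$$ Then for all $t\in[0,t_*)$ the integrals $I_{\mathbf{m},\mathbf{m}'}$ and $I_{\mathbf{n},\mathbf{n}'}$ converge, and $$I_{\mathbf{m},\mathbf{m}'}=\begin{cases}\dfrac{p_{\mathbf{m}}\,p'_{\mathbf{m}'}}{p_{\mathbf{n}}\,p'_{\mathbf{n}'}}\,\varrho^{-t}\,I_{\mathbf{n},\mathbf{n}'}, & t\in(0,t_*),\\[3mm] p_{\mathbf{m}}\,p'_{\mathbf{m}'}\left(\mu(\Gamma)\,\mu'(\Gamma)\log\varrho+\dfrac{1}{p_{\mathbf{n}}\,p'_{\mathbf{n}'}}\,I_{\mathbf{n},\mathbf{n}'}\right), & t=0.\end{cases}$$ -/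

import Mathlib

open MeasureTheory Set
open scoped ENNReal

/-- An iterated function system of `M ≥ 2` contracting similarities of `ℝⁿ`. -/
structure SimilarityIFS (n M : ℕ) where
  /-- the maps `s₁, …, s_M` -/
  s : Fin M → EuclideanSpace ℝ (Fin n) → EuclideanSpace ℝ (Fin n)
  /-- the contraction factors `ρ₁, …, ρ_M` -/
  ρ : Fin M → ℝ
  two_le : 2 ≤ M
  ρ_pos : ∀ i, 0 < ρ i
  ρ_lt_one : ∀ i, ρ i < 1
  dist_map : ∀ i x y, dist (s i x) (s i y) = ρ i * dist x y

namespace SimilarityIFS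

variable {n M : ℕ} (F : SimilarityIFS n M)

/-- `Γ` is the attractor: the (unique) non-empty compact set with `Γ = ⋃ᵢ sᵢ(Γ)`. -/
structure IsAttractor (Γ : Set (EuclideanSpace ℝ (Fin n))) : Prop where
  nonempty : Γ.Nonempty
  isCompact : IsCompact Γ
  eq_iUnion : Γ = ⋃ i, F.s i '' Γ

/-- The open set condition. -/
def OpenSetCondition : Prop :=
  ∃ O : Set (EuclideanSpace ℝ (Fin n)),
    O.Nonempty ∧ Bornology.IsBounded O ∧ IsOpen O ∧
    (⋃ i, F.s i '' O) ⊆ O ∧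
    ∀ i j, i ≠ j → Disjoint (F.s i '' O) (F.s j '' O)

/-- A similarity of `ℝⁿ` is a bijection. -/
theorem bijective_s (i : Fin M) : Function.Bijective (F.s i) := by
  have hρ := F.ρ_pos i
  have hiso : Isometry (fun x => (F.ρ i)⁻¹ • F.s i x) := by
    refine Isometry.of_dist_eq fun x y => ?_
    rw [dist_smul₀, F.dist_map, Real.norm_of_nonneg (inv_nonneg.2 hρ.le)]
    field_simp
  have hb : Function.Bijective (fun x => (F.ρ i)⁻¹ • F.s i x) :=
    (hiso.affineIsometryOfStrictConvexSpace.toAffineIsometryEquiv rfl).bijective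
  constructor
  · intro x y h
    exact hb.1 (by simp only [h])
  · intro y
    obtain ⟨x, hx⟩ := hb.2 ((F.ρ i)⁻¹ • y)
    exact ⟨x, smul_right_injective _ (inv_ne_zero hρ.ne') hx⟩

/-- `s_m = s_{m₁} ∘ ⋯ ∘ s_{m_ℓ}` for a vector index `m = (m₁, …, m_ℓ)` (a list of any length,
the empty list giving the identity), as a bijection of `ℝⁿ`. -/
noncomputable def word :
    List (Fin M) → EuclideanSpace ℝ (Fin n) ≃ EuclideanSpace ℝ (Fin n)
  | [] => Equiv.refl _
  | i :: m => (word m).trans (Equiv.ofBijective (F.s i) (F.bijective_s i))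

theorem word_nil (x : EuclideanSpace ℝ (Fin n)) : F.word [] x = x := rfl

theorem word_cons (i : Fin M) (m : List (Fin M)) (x : EuclideanSpace ℝ (Fin n)) :
    F.word (i :: m) x = F.s i (F.word m x) := rfl

/-- `Γ_m = s_m(Γ)`. -/
def piece (Γ : Set (EuclideanSpace ℝ (Fin n))) (m : List (Fin M)) :
    Set (EuclideanSpace ℝ (Fin n)) :=
  F.word m '' Γ

/-- `μ` is a self-similar measure on `Γ` with weights `p₁, …, p_M`: a non-zero finite Borel
measure supported on `Γ` with `μ(E) = ∑ᵢ pᵢ μ(sᵢ⁻¹(E))`, where `0 < pᵢ < 1`, `∑ᵢ pᵢ = 1`. -/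
structure IsSelfSimilarMeasure (Γ : Set (EuclideanSpace ℝ (Fin n))) (p : Fin M → ℝ)
    (μ : Measure (EuclideanSpace ℝ (Fin n))) : Prop where
  weight_pos : ∀ i, 0 < p i
  weight_lt_one : ∀ i, p i < 1
  weight_sum : ∑ i, p i = 1
  isFiniteMeasure : IsFiniteMeasure μ
  ne_zero : μ ≠ 0
  supported : μ Γᶜ = 0
  self_similar : ∀ E, MeasurableSet E → μ E = ∑ i, ENNReal.ofReal (p i) * μ (F.s i ⁻¹' E)

end SimilarityIFS

/-- `p_m = p_{m₁} ⋯ p_{m_ℓ}`, the empty product being `1`. -/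
def wordWeight {M : ℕ} (p : Fin M → ℝ) (m : List (Fin M)) : ℝ :=
  (m.map p).prod

/-- `μ` is invariant under the isometry `T`: `μ(T(E)) = μ(E)` for all measurable `E`. -/
def InvariantUnder {n : ℕ} (μ : Measure (EuclideanSpace ℝ (Fin n)))
    (T : EuclideanSpace ℝ (Fin n) ≃ᵢ EuclideanSpace ℝ (Fin n)) : Prop :=
  ∀ E, MeasurableSet E → μ (T '' E) = μ E

/-- The kernel `Φ_t(x,y)`, equal to `|x-y|^(-t)` for `t > 0` and to `log |x-y|` for `t = 0`.
On the diagonal, where the kernel is infinite, the Lean value is `0`; the diagonal is required to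
be a null set in `SimilarityIFS.SubIntegralConverges`, so this value never matters. -/
noncomputable def kernelΦ {n : ℕ} (t : ℝ) (x y : EuclideanSpace ℝ (Fin n)) : ℝ :=
  if t = 0 then Real.log (dist x y) else dist x y ^ (-t)

namespace SimilarityIFS

variable {n M : ℕ} (F : SimilarityIFS n M)

/-- The sub-integral `I_{m,m'} = ∫_{Γ_m} (∫_{Γ_{m'}} Φ_t(x,y) dμ'(y)) dμ(x)`. -/
noncomputable def subIntegral (Γ : Set (EuclideanSpace ℝ (Fin n)))
    (μ μ' : Measure (EuclideanSpace ℝ (Fin n))) (t : ℝ) (m m' : List (Fin M)) : ℝ :=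
  ∫ x in F.piece Γ m, (∫ y in F.piece Γ m', kernelΦ t x y ∂μ') ∂μ

/-- `I_{m,m'}` converges (absolutely): the kernel, which is infinite on the diagonal, is
integrable over `Γ_m × Γ_{m'}`. -/
def SubIntegralConverges (Γ : Set (EuclideanSpace ℝ (Fin n)))
    (μ μ' : Measure (EuclideanSpace ℝ (Fin n))) (t : ℝ) (m m' : List (Fin M)) : Prop :=
  (μ.prod μ') ((F.piece Γ m ×ˢ F.piece Γ m') ∩ {z | z.1 = z.2}) = 0 ∧
  IntegrableOn (fun z : EuclideanSpace ℝ (Fin n) × EuclideanSpace ℝ (Fin n) =>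
    kernelΦ t z.1 z.2) (F.piece Γ m ×ˢ F.piece Γ m') (μ.prod μ')

/-- `t_*`, the largest number such that `I_{Γ,Γ} = I_{∅,∅}` converges for all `0 ≤ t < t_*`
(the supremum is attained, and it is `0` if there is no positive number with this property). -/
noncomputable def tStar (Γ : Set (EuclideanSpace ℝ (Fin n)))
    (μ μ' : Measure (EuclideanSpace ℝ (Fin n))) : ℝ≥0∞ :=
  sSup {τ : ℝ≥0∞ | ∀ t : ℝ, 0 ≤ t → ENNReal.ofReal t < τ →
    F.SubIntegralConverges Γ μ μ' t [] []}

end SimilarityIFS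

/-! ### Word maps as similarities and homeomorphisms -/

namespace SimilarityIFS

variable {n M : ℕ} (F : SimilarityIFS n M)

/-! The map `s_m ∘ T ∘ s_k⁻¹` carries `μ` restricted to `Γ_k` to a multiple of `μ` restricted to
`Γ_m`, with factor given by the weights. Changing variables this way in both integrals leaves a
kernel whose distance is multiplied by `r`, which produces the factor `r ^ (-t)` or the summand `log
r`.

The substance is `restrict_piece`: on `Γ_m`, `μ` is `p_m` times its image under `s_m`. This requires
overlaps of distinct first-level pieces to carry no mass. By a volume count, the open set condition
bounds the number `N_k(x)` of level-`k` pieces through `x`, uniformly in `k` and `x`. These counts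
increase in `k`, and their limit `f` satisfies `f = ∑ j, f ∘ s_j⁻¹`. Integrating against the
self-similar `μ` gives `∫ f = ∫ f + ∑ i, p_i ∫ g_i`, where `g_i` collects the terms `f ∘ s_j⁻¹ ∘
s_i` with `j ≠ i`. As `∫ f` is finite, each `g_i` vanishes almost everywhere, and `f ≥ 1` on `Γ`
makes the overlaps null. -/

theorem exists_dist_word (m : List (Fin M)) :
    ∃ c : ℝ, 0 < c ∧ ∀ x y, dist (F.word m x) (F.word m y) = c * dist x y := by
  induction m with
  | nil => exact ⟨1, one_pos, fun x y => by simp [word_nil]⟩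
  | cons i m ih =>
    obtain ⟨c, hc, h⟩ := ih
    exact ⟨F.ρ i * c, mul_pos (F.ρ_pos i) hc, fun x y => by
      rw [word_cons, word_cons, F.dist_map, h, mul_assoc]⟩

/-- The bijection `s_m` as a homeomorphism. -/
noncomputable def wordHomeo (m : List (Fin M)) :
    EuclideanSpace ℝ (Fin n) ≃ₜ EuclideanSpace ℝ (Fin n) where
  toEquiv := F.word m
  continuous_toFun := by
    obtain ⟨c, hc, h⟩ := F.exists_dist_word m
    exact (LipschitzWith.of_dist_le_mul (K := ⟨c, hc.le⟩) fun x y => (h x y).le).continuous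
  continuous_invFun := by
    obtain ⟨c, hc, h⟩ := F.exists_dist_word m
    refine (LipschitzWith.of_dist_le_mul (K := ⟨c⁻¹, (inv_pos.2 hc).le⟩) fun x y => ?_).continuous
    have := h ((F.word m).symm x) ((F.word m).symm y)
    simp only [Equiv.apply_symm_apply] at this
    rw [this]
    change _ ≤ c⁻¹ * (c * dist ((F.word m).symm x) ((F.word m).symm y))
    rw [inv_mul_cancel_left₀ hc.ne']
    rfl

theorem measurable_word (m : List (Fin M)) : Measurable (F.word m) :=
  (F.wordHomeo m).continuous.measurable

theorem continuous_s (i : Fin M) : Continuous (F.s i) := (F.wordHomeo [i]).continuous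

theorem s_symm_apply (i : Fin M) (x : EuclideanSpace ℝ (Fin n)) :
    F.s i ((F.wordHomeo [i]).symm x) = x := (F.wordHomeo [i]).apply_symm_apply x

theorem symm_s_apply (i : Fin M) (x : EuclideanSpace ℝ (Fin n)) :
    (F.wordHomeo [i]).symm (F.s i x) = x := (F.wordHomeo [i]).symm_apply_apply x

/-! ### Volume bound on the number of pieces through a point -/

theorem exists_ratio_bounds :
    ∃ a b : ℝ, 0 < a ∧ a ≤ 1 ∧ 0 < b ∧ b < 1 ∧ ∀ i, a ≤ F.ρ i ∧ F.ρ i ≤ b := by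
  have : Nonempty (Fin M) := ⟨⟨0, by have := F.two_le; omega⟩⟩
  obtain ⟨i, hi⟩ := Finite.exists_min F.ρ
  obtain ⟨j, hj⟩ := Finite.exists_max F.ρ
  exact ⟨F.ρ i, F.ρ j, F.ρ_pos i, (F.ρ_lt_one i).le, F.ρ_pos j, F.ρ_lt_one j,
    fun k => ⟨hi k, hj k⟩⟩

/-- The number of words `m` of length `k` with `x ∈ Γ_m`. -/
noncomputable def coverCount (Γ : Set (EuclideanSpace ℝ (Fin n))) :
    ℕ → EuclideanSpace ℝ (Fin n) → ℝ≥0∞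
  | 0, x => Γ.indicator 1 x
  | k + 1, x => ∑ i, coverCount Γ k ((F.wordHomeo [i]).symm x)

/-- Hausdorff measure serves as volume: its scaling follows from the metric property of `s i` alone,
and in the full dimension it is a Haar measure. -/
theorem ratio_pow_mul_hausdorffMeasure_le (i : Fin M) (d : ℕ)
    (S : Set (EuclideanSpace ℝ (Fin n))) :
    ENNReal.ofReal (F.ρ i ^ d) * μH[d] S ≤ μH[d] (F.s i '' S) := by
  have hρ := F.ρ_pos i
  have h : AntilipschitzWith (F.ρ i)⁻¹.toNNReal (F.s i) :=
    AntilipschitzWith.of_le_mul_dist fun x y => by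
      rw [F.dist_map, Real.coe_toNNReal _ (inv_pos.2 hρ).le, inv_mul_cancel_left₀ hρ.ne']
  have h2 := h.le_hausdorffMeasure_image d.cast_nonneg S
  rw [← ENNReal.ofReal, ENNReal.rpow_natCast, ← ENNReal.ofReal_pow (inv_pos.2 hρ).le] at h2
  calc ENNReal.ofReal (F.ρ i ^ d) * μH[d] S
      ≤ ENNReal.ofReal (F.ρ i ^ d) * (ENNReal.ofReal ((F.ρ i)⁻¹ ^ d) * μH[d] (F.s i '' S)) := by
        gcongr
    _ = μH[d] (F.s i '' S) := by
        rw [← mul_assoc, ← ENNReal.ofReal_mul (by positivity), ← mul_pow,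
          mul_inv_cancel₀ hρ.ne', one_pow, ENNReal.ofReal_one, one_mul]

theorem ratio_pow_mul_hausdorffMeasure_ball_le {O : Set (EuclideanSpace ℝ (Fin n))}
    (i : Fin M) (d : ℕ) (x : EuclideanSpace ℝ (Fin n)) (r : ℝ) :
    ENNReal.ofReal (F.ρ i ^ d) * μH[d] (O ∩ Metric.closedBall x (r / F.ρ i)) ≤
      μH[d] (F.s i '' O ∩ Metric.closedBall (F.s i x) r) := by
  refine (F.ratio_pow_mul_hausdorffMeasure_le i d _).trans (measure_mono ?_)
  rintro _ ⟨y, ⟨hy, hyx⟩, rfl⟩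
  refine ⟨⟨y, hy, rfl⟩, ?_⟩
  rw [Metric.mem_closedBall, F.dist_map]
  rwa [Metric.mem_closedBall, le_div_iff₀' (F.ρ_pos i)] at hyx

/-- Zooming in along an address of `x` reduces small radii to `r ∈ [a, 1]`, where the ball swallows
all of `O`; each zoom preserves the ratio of volume to `r ^ d`. -/
theorem pow_mul_hausdorffMeasure_le {Γ O : Set (EuclideanSpace ℝ (Fin n))}
    (hΓ : F.IsAttractor Γ) (hOs : (⋃ i, F.s i '' O) ⊆ O)
    (hb : Bornology.IsBounded O) :
    ∃ D : ℝ, 0 < D ∧ ∀ (d : ℕ), ∀ x ∈ Γ, ∀ r : ℝ, 0 < r → r ≤ 1 →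
      ENNReal.ofReal (r ^ d) * μH[d] O ≤ μH[d] (O ∩ Metric.closedBall x (D * r)) := by
  obtain ⟨a, b, ha, ha1, hb0, hb1, hab⟩ := F.exists_ratio_bounds
  obtain ⟨C, hC0, hC⟩ := (hb.union hΓ.isCompact.isBounded).subset_closedBall_lt 0 0
  have hdist : ∀ x ∈ Γ, ∀ y ∈ O, dist y x ≤ 2 * C := fun x hx y hy => by
    have h1 := hC (Or.inr hx)
    have h2 := hC (Or.inl hy)
    rw [Metric.mem_closedBall] at h1 h2
    linarith [dist_triangle_right y x 0]
  -- Points of `O` lie within `2 * C` of points of `Γ`; dividing by `a` makes the ball contain `O`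
  -- as soon as `r ≥ a`.
  refine ⟨2 * C / a, by positivity, fun d => ?_⟩
  have large : ∀ x ∈ Γ, ∀ r : ℝ, a ≤ r → r ≤ 1 →
      ENNReal.ofReal (r ^ d) * μH[d] O ≤ μH[d] (O ∩ Metric.closedBall x (2 * C / a * r)) := by
    intro x hx r har hr1
    have : O ∩ Metric.closedBall x (2 * C / a * r) = O := by
      refine inter_eq_left.2 fun y hy => (hdist x hx y hy).trans ?_
      rw [div_mul_eq_mul_div, le_div_iff₀ ha]
      gcongr
    rw [this]
    refine mul_le_of_le_one_left zero_le ?_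
    rw [ENNReal.ofReal_le_one]
    exact pow_le_one₀ (ha.le.trans har) hr1
  have key : ∀ k : ℕ, ∀ x ∈ Γ, ∀ r : ℝ, a * b ^ k ≤ r → r ≤ 1 →
      ENNReal.ofReal (r ^ d) * μH[d] O ≤ μH[d] (O ∩ Metric.closedBall x (2 * C / a * r)) := by
    intro k
    induction k with
    | zero => simpa using large
    | succ k ih =>
      intro x hx r hr hr1
      rcases le_or_gt a r with har | har
      · exact large x hx r har hr1
      have hx' := hx
      rw [hΓ.eq_iUnion] at hx'
      obtain ⟨i, y, hy, rfl⟩ := mem_iUnion.1 hx'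
      have hρ := F.ρ_pos i
      have hr0 : 0 < r := lt_of_lt_of_le (by positivity) hr
      have h := ih y hy (r / F.ρ i)
        (by
          rw [le_div_iff₀ hρ]
          refine le_trans ?_ hr
          rw [pow_succ, ← mul_assoc]
          gcongr
          exact (hab i).2)
        (by rw [div_le_one hρ]; exact har.le.trans (hab i).1)
      calc ENNReal.ofReal (r ^ d) * μH[d] O
          = ENNReal.ofReal (F.ρ i ^ d) * (ENNReal.ofReal ((r / F.ρ i) ^ d) * μH[d] O) := by
            rw [← mul_assoc, ← ENNReal.ofReal_mul (by positivity), ← mul_pow,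
              mul_div_cancel₀ _ hρ.ne']
        _ ≤ ENNReal.ofReal (F.ρ i ^ d) *
              μH[d] (O ∩ Metric.closedBall y (2 * C / a * (r / F.ρ i))) := by gcongr
        _ ≤ μH[d] (F.s i '' O ∩ Metric.closedBall (F.s i y) (2 * C / a * r)) := by
            rw [← mul_div_assoc]
            exact F.ratio_pow_mul_hausdorffMeasure_ball_le i d y _
        _ ≤ _ := by
            gcongr
            exact (subset_iUnion (fun i => F.s i '' O) i).trans hOs
  intro x hx r hr hr1
  obtain ⟨k, hk⟩ := exists_pow_lt_of_lt_one hr hb1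
  exact key k x hx r ((mul_le_of_le_one_left (by positivity) ha1).trans hk.le) hr1

/-- Each level-`k` piece through `x` forces its copy of `O` to occupy volume of order `a ^ (k * d)`
in the ball of radius `D * a ^ k`. These copies are disjoint, so comparison with the volume of the
ball bounds their number. -/
theorem exists_coverCount_le {Γ : Set (EuclideanSpace ℝ (Fin n))}
    (hΓ : F.IsAttractor Γ) (hosc : F.OpenSetCondition) :
    ∃ C : ℝ≥0∞, C ≠ ∞ ∧ ∀ k x, F.coverCount Γ k x ≤ C := by
  obtain ⟨O, hne, hbd, hopen, hOs, hdisj⟩ := hosc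
  obtain ⟨D, hD, hbase⟩ := F.pow_mul_hausdorffMeasure_le hΓ hOs hbd
  obtain ⟨a, b, ha, ha1, -, -, hab⟩ := F.exists_ratio_bounds
  set d := Module.finrank ℝ (EuclideanSpace ℝ (Fin n)) with hd
  -- The condition `r ≤ a ^ k` keeps the radius at most `1` after `k` divisions by contraction
  -- ratios.
  have key : ∀ k : ℕ, ∀ x, ∀ r : ℝ, 0 < r → r ≤ a ^ k →
      F.coverCount Γ k x * (ENNReal.ofReal (r ^ d) * μH[d] O) ≤
        μH[d] (O ∩ Metric.closedBall x (D * r)) := by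
    intro k
    induction k with
    | zero =>
      intro x r hr hr1
      by_cases hx : x ∈ Γ
      · simpa [coverCount, hx] using hbase d x hx r hr (by simpa using hr1)
      · simp [coverCount, hx]
    | succ k ih =>
      intro x r hr hr1
      have step : ∀ i, F.coverCount Γ k ((F.wordHomeo [i]).symm x) *
          (ENNReal.ofReal (r ^ d) * μH[d] O) ≤
          μH[d] (F.s i '' O ∩ Metric.closedBall x (D * r)) := by
        intro i
        have hρ := F.ρ_pos i
        have h := ih ((F.wordHomeo [i]).symm x) (r / F.ρ i) (by positivity) (by
          rw [div_le_iff₀ hρ]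
          refine hr1.trans ?_
          rw [pow_succ]
          gcongr
          exact (hab i).1)
        calc F.coverCount Γ k ((F.wordHomeo [i]).symm x) * (ENNReal.ofReal (r ^ d) * μH[d] O)
            = ENNReal.ofReal (F.ρ i ^ d) * (F.coverCount Γ k ((F.wordHomeo [i]).symm x) *
                (ENNReal.ofReal ((r / F.ρ i) ^ d) * μH[d] O)) := by
              rw [mul_left_comm (ENNReal.ofReal (F.ρ i ^ d)),
                ← mul_assoc (ENNReal.ofReal (F.ρ i ^ d)), ← ENNReal.ofReal_mul (by positivity),
                ← mul_pow, mul_div_cancel₀ _ hρ.ne']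
          _ ≤ ENNReal.ofReal (F.ρ i ^ d) *
                μH[d] (O ∩ Metric.closedBall ((F.wordHomeo [i]).symm x) (D * (r / F.ρ i))) := by
              gcongr
          _ ≤ μH[d] (F.s i '' O ∩
                Metric.closedBall (F.s i ((F.wordHomeo [i]).symm x)) (D * r)) := by
              rw [← mul_div_assoc]
              exact F.ratio_pow_mul_hausdorffMeasure_ball_le i d _ _
          _ = _ := by rw [s_symm_apply]
      calc F.coverCount Γ (k + 1) x * (ENNReal.ofReal (r ^ d) * μH[d] O)
          = ∑ i, F.coverCount Γ k ((F.wordHomeo [i]).symm x) *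
              (ENNReal.ofReal (r ^ d) * μH[d] O) := by rw [coverCount, Finset.sum_mul]
        _ ≤ ∑ i, μH[d] (F.s i '' O ∩ Metric.closedBall x (D * r)) :=
            Finset.sum_le_sum fun i _ => step i
        _ = μH[d] (⋃ i, F.s i '' O ∩ Metric.closedBall x (D * r)) := by
            rw [measure_iUnion, tsum_fintype]
            · exact fun i j hij => (hdisj i j hij).mono inter_subset_left inter_subset_left
            · exact fun i => (((F.wordHomeo [i]).isOpenMap O hopen).measurableSet).inter
                Metric.isClosed_closedBall.measurableSet
        _ ≤ _ := measure_mono (by rw [← iUnion_inter]; gcongr)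
  set B : ℝ≥0∞ := μH[d] (Metric.ball (0 : EuclideanSpace ℝ (Fin n)) 1) with hB
  have hBtop : B ≠ ∞ := Metric.isBounded_ball.measure_lt_top.ne
  have hV0 : μH[d] O ≠ 0 := (hopen.measure_pos _ hne).ne'
  have hVtop : μH[d] O ≠ ∞ := hbd.measure_lt_top.ne
  refine ⟨ENNReal.ofReal (D ^ d) * B / μH[d] O,
    ENNReal.div_ne_top (ENNReal.mul_ne_top ENNReal.ofReal_ne_top hBtop) hV0, fun k x => ?_⟩
  have hr : (0 : ℝ) < a ^ k := by positivity
  have h := (key k x (a ^ k) hr le_rfl).trans (measure_mono inter_subset_right)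
  rw [hd, Measure.addHaar_closedBall _ _ (by positivity), ← hd, ← hB, mul_pow,
    ENNReal.ofReal_mul (by positivity)] at h
  rw [ENNReal.le_div_iff_mul_le (Or.inl hV0) (Or.inl hVtop)]
  -- At `r = a ^ k` this factor occurs on both sides; cancelling it leaves a bound free of `k`.
  have hc0 : ENNReal.ofReal ((a ^ k) ^ d) ≠ 0 := by
    rw [Ne, ENNReal.ofReal_eq_zero, not_le]; positivity
  refine (ENNReal.mul_le_mul_iff_right hc0 ENNReal.ofReal_ne_top).1 ?_
  calc _ = F.coverCount Γ k x * (ENNReal.ofReal ((a ^ k) ^ d) * μH[d] O) := by ring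
    _ ≤ _ := h
    _ = _ := by ring

theorem measurable_coverCount {Γ : Set (EuclideanSpace ℝ (Fin n))} (hΓ : MeasurableSet Γ) (k : ℕ) :
    Measurable (F.coverCount Γ k) := by
  induction k with
  | zero => exact measurable_one.indicator hΓ
  | succ k ih =>
    exact Finset.measurable_fun_sum _ fun i _ =>
      ih.comp (F.wordHomeo [i]).symm.continuous.measurable

/-- Every point of `Γ` lies in some `s_i(Γ)`, so refining a piece never loses a point. -/
theorem monotone_coverCount {Γ : Set (EuclideanSpace ℝ (Fin n))} (hΓ : F.IsAttractor Γ)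
    (x : EuclideanSpace ℝ (Fin n)) : Monotone fun k => F.coverCount Γ k x := by
  refine monotone_nat_of_le_succ fun k => ?_
  induction k generalizing x with
  | zero =>
    by_cases hx : x ∈ Γ
    · have hx' := hx
      rw [hΓ.eq_iUnion] at hx'
      obtain ⟨i, y, hy, rfl⟩ := mem_iUnion.1 hx'
      calc F.coverCount Γ 0 (F.s i y) = 1 := by simp [coverCount, hx]
        _ = F.coverCount Γ 0 ((F.wordHomeo [i]).symm (F.s i y)) := by
          rw [symm_s_apply]; simp [coverCount, hy]
        _ ≤ _ := Finset.single_le_sum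
          (f := fun j => F.coverCount Γ 0 ((F.wordHomeo [j]).symm (F.s i y)))
          (fun _ _ => zero_le) (Finset.mem_univ i)
    · simp [coverCount, hx]
  | succ k ih => exact Finset.sum_le_sum fun i _ => ih _

/-! ### Pieces of the attractor and convergence of sub-integrals -/

theorem piece_nil (Γ : Set (EuclideanSpace ℝ (Fin n))) : F.piece Γ [] = Γ := by
  simp [piece, word]

theorem piece_subset {Γ : Set (EuclideanSpace ℝ (Fin n))} (hΓ : F.IsAttractor Γ)
    (m : List (Fin M)) : F.piece Γ m ⊆ Γ := by
  induction m with
  | nil => rw [piece_nil]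
  | cons i m ih =>
    rintro _ ⟨x, hx, rfl⟩
    rw [hΓ.eq_iUnion]
    exact mem_iUnion.2 ⟨i, _, ih ⟨x, hx, rfl⟩, rfl⟩

theorem SubIntegralConverges.of_nil {F : SimilarityIFS n M}
    {Γ : Set (EuclideanSpace ℝ (Fin n))} (hΓ : F.IsAttractor Γ)
    {μ μ' : Measure (EuclideanSpace ℝ (Fin n))} {t : ℝ}
    (h : F.SubIntegralConverges Γ μ μ' t [] []) (m m' : List (Fin M)) :
    F.SubIntegralConverges Γ μ μ' t m m' := by
  have hsub : F.piece Γ m ×ˢ F.piece Γ m' ⊆ F.piece Γ [] ×ˢ F.piece Γ [] := by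
    rw [piece_nil]
    exact prod_mono (F.piece_subset hΓ m) (F.piece_subset hΓ m')
  exact ⟨measure_mono_null (inter_subset_inter_left _ hsub) h.1, h.2.mono_set hsub⟩

theorem subIntegralConverges_of_lt_tStar {Γ : Set (EuclideanSpace ℝ (Fin n))}
    {μ μ' : Measure (EuclideanSpace ℝ (Fin n))} {t : ℝ} (ht : 0 ≤ t)
    (h : ENNReal.ofReal t < F.tStar Γ μ μ') : F.SubIntegralConverges Γ μ μ' t [] [] := by
  obtain ⟨τ, hτ, htτ⟩ := lt_sSup_iff.1 h
  exact hτ t ht htτ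

/-! ### Null overlaps and the restriction of a self-similar measure to a piece -/

namespace IsSelfSimilarMeasure

variable {F} {Γ : Set (EuclideanSpace ℝ (Fin n))} {p : Fin M → ℝ}
  {μ : Measure (EuclideanSpace ℝ (Fin n))}

theorem eq_sum_map (hμ : F.IsSelfSimilarMeasure Γ p μ) :
    μ = ∑ i, ENNReal.ofReal (p i) • μ.map (F.s i) := by
  ext E hE
  rw [hμ.self_similar E hE, Measure.finsetSum_apply]
  exact Finset.sum_congr rfl fun i _ => by
    rw [Measure.smul_apply, Measure.map_apply (F.continuous_s i).measurable hE, smul_eq_mul]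

/-- The limiting count `f` has a finite integral that self-similarity reproduces with an extra
overlap term, which must therefore vanish. -/
theorem measure_preimage_image_eq_zero (hμ : F.IsSelfSimilarMeasure Γ p μ)
    (hΓ : F.IsAttractor Γ) (hosc : F.OpenSetCondition) {i j : Fin M} (hij : j ≠ i) :
    μ (F.s i ⁻¹' (F.s j '' Γ)) = 0 := by
  have := hμ.isFiniteMeasure
  obtain ⟨C, hC, hle⟩ := F.exists_coverCount_le hΓ hosc
  set f : EuclideanSpace ℝ (Fin n) → ℝ≥0∞ := fun x => ⨆ k, F.coverCount Γ k x with hf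
  have hfm : Measurable f :=
    Measurable.iSup fun k => F.measurable_coverCount hΓ.isCompact.measurableSet k
  -- The recursion for the counts passes to the limit: monotonicity lets the supremum commute with
  -- the finite sum and absorbs the index shift.
  have hfsum : ∀ x, f x = ∑ j, f ((F.wordHomeo [j]).symm x) := fun x => by
    simp only [hf]
    rw [ENNReal.finsetSum_iSup_of_monotone fun j => F.monotone_coverCount hΓ _]
    exact ((F.monotone_coverCount hΓ x).iSup_nat_add 1).symm
  have hffin : ∫⁻ x, f x ∂μ ≠ ∞ := by
    refine ne_top_of_le_ne_top ?_ (lintegral_mono (g := fun _ => C) fun x => iSup_le fun k => hle k x)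
    rw [lintegral_const]
    exact ENNReal.mul_ne_top hC (measure_ne_top _ _)
  have hfs : ∀ i x, f (F.s i x) =
      f x + ∑ j ∈ Finset.univ.erase i, f ((F.wordHomeo [j]).symm (F.s i x)) := fun i x => by
    rw [hfsum, ← Finset.add_sum_erase _ _ (Finset.mem_univ i), symm_s_apply]
  set g : Fin M → EuclideanSpace ℝ (Fin n) → ℝ≥0∞ := fun i x =>
    ∑ j ∈ Finset.univ.erase i, f ((F.wordHomeo [j]).symm (F.s i x)) with hg
  have hgm : ∀ i, Measurable (g i) := fun i => Finset.measurable_fun_sum _ fun j _ =>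
    hfm.comp ((F.wordHomeo [j]).symm.continuous.comp (F.continuous_s i)).measurable
  have hw : ∑ i, ENNReal.ofReal (p i) = 1 := by
    rw [← ENNReal.ofReal_sum_of_nonneg fun i _ => (hμ.weight_pos i).le, hμ.weight_sum,
      ENNReal.ofReal_one]
  have hint : ∫⁻ x, f x ∂μ =
      ∫⁻ x, f x ∂μ + ∑ i, ENNReal.ofReal (p i) * ∫⁻ x, g i x ∂μ := by
    calc ∫⁻ x, f x ∂μ = ∫⁻ x, f x ∂(∑ i, ENNReal.ofReal (p i) • μ.map (F.s i)) := by
          rw [← hμ.eq_sum_map]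
      _ = ∑ i, ENNReal.ofReal (p i) * (∫⁻ x, f x ∂μ + ∫⁻ x, g i x ∂μ) := by
          rw [lintegral_finsetSum_measure]
          refine Finset.sum_congr rfl fun i _ => ?_
          rw [lintegral_smul_measure, lintegral_map hfm (F.continuous_s i).measurable,
            ← lintegral_add_left hfm, smul_eq_mul]
          exact congrArg _ (lintegral_congr fun x => hfs i x)
      _ = _ := by
          simp_rw [mul_add]
          rw [Finset.sum_add_distrib, ← Finset.sum_mul, hw, one_mul]
  have hz : ∑ i, ENNReal.ofReal (p i) * ∫⁻ x, g i x ∂μ = 0 :=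
    (ENNReal.add_right_inj hffin).1 (by rw [add_zero]; exact hint.symm)
  have hgi : ∫⁻ x, g i x ∂μ = 0 := by
    rw [Finset.sum_eq_zero_iff] at hz
    refine (mul_eq_zero.1 (hz i (Finset.mem_univ i))).resolve_left ?_
    rw [ENNReal.ofReal_eq_zero, not_le]
    exact hμ.weight_pos i
  rw [lintegral_eq_zero_iff (hgm i)] at hgi
  refine measure_mono_null ?_ hgi
  rintro x ⟨y, hy, hyx⟩ h0
  simp only [hg, Pi.zero_apply, Finset.sum_eq_zero_iff] at h0
  have h1 := h0 j (Finset.mem_erase.2 ⟨hij, Finset.mem_univ j⟩)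
  rw [← hyx, symm_s_apply] at h1
  -- The level-`0` count is the indicator of `Γ`, so `f y ≥ 1`, against `f y = 0`.
  have h2 : F.coverCount Γ 0 y ≤ f y := le_iSup (fun k => F.coverCount Γ k y) 0
  rw [h1] at h2
  simp [coverCount, hy] at h2

/-- In the self-similarity formula for `E ∩ s_i(Γ)`, the terms with `j ≠ i` live on null overlaps.
-/
theorem restrict_image (hμ : F.IsSelfSimilarMeasure Γ p μ)
    (hΓ : F.IsAttractor Γ) (hosc : F.OpenSetCondition) (i : Fin M) :
    μ.restrict (F.s i '' Γ) = ENNReal.ofReal (p i) • μ.map (F.s i) := by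
  have hm : MeasurableSet (F.s i '' Γ) :=
    (hΓ.isCompact.image (F.continuous_s i)).measurableSet
  ext E hE
  rw [Measure.restrict_apply hE, hμ.self_similar _ (hE.inter hm), Measure.smul_apply,
    Measure.map_apply (F.continuous_s i).measurable hE, smul_eq_mul, Finset.sum_eq_single i]
  · rw [preimage_inter, preimage_image_eq _ (F.bijective_s i).1,
      measure_inter_conull hμ.supported]
  · intro j _ hj
    rw [measure_mono_null (preimage_mono inter_subset_right)
      (hμ.measure_preimage_image_eq_zero hΓ hosc hj.symm), mul_zero]
  · simp

theorem restrict_piece (hμ : F.IsSelfSimilarMeasure Γ p μ)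
    (hΓ : F.IsAttractor Γ) (hosc : F.OpenSetCondition) (m : List (Fin M)) :
    μ.restrict (F.piece Γ m) = ENNReal.ofReal (wordWeight p m) • μ.map (F.word m) := by
  induction m with
  | nil =>
    have h2 : μ.map (F.word []) = μ := Measure.map_id
    rw [F.piece_nil, h2]
    simp only [wordWeight, List.map_nil, List.prod_nil, ENNReal.ofReal_one, one_smul]
    exact Measure.restrict_eq_self_of_ae_mem (measure_eq_zero_iff_ae_notMem.1 hμ.supported |>.mono
      fun x hx => not_not.1 hx)
  | cons i m ih =>
    have hpiece : F.piece Γ (i :: m) = F.s i '' F.piece Γ m := by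
      rw [piece, piece, image_image]; rfl
    have hmeas : MeasurableSet (F.s i '' F.piece Γ m) :=
      ((hΓ.isCompact.image (F.wordHomeo m).continuous).image (F.continuous_s i)).measurableSet
    have hword : μ.map (F.word (i :: m)) = (μ.map (F.word m)).map (F.s i) :=
      (Measure.map_map (F.continuous_s i).measurable (F.measurable_word m)).symm
    -- Since `s_i(Γ_m) ⊆ s_i(Γ)`, restriction can be done in two stages, the outer letter first.
    rw [hpiece, ← inter_eq_left.2 (image_mono (f := F.s i) (F.piece_subset hΓ m)),
      ← Measure.restrict_restrict hmeas, hμ.restrict_image hΓ hosc, Measure.restrict_smul,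
      Measure.restrict_map (F.continuous_s i).measurable hmeas,
      preimage_image_eq _ (F.bijective_s i).1, ih, Measure.map_smul, smul_smul, hword, wordWeight,
      wordWeight, List.map_cons, List.prod_cons, ENNReal.ofReal_mul (hμ.weight_pos i).le]

end IsSelfSimilarMeasure

end SimilarityIFS

/-! ### Scaling of the kernel and transport between pieces -/

theorem wordWeight_pos {M : ℕ} {p : Fin M → ℝ} (hp : ∀ i, 0 < p i) (m : List (Fin M)) :
    0 < wordWeight p m := by
  refine List.prod_pos fun x hx => ?_
  obtain ⟨i, -, rfl⟩ := List.mem_map.1 hx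
  exact hp i

theorem InvariantUnder.map_eq {n : ℕ} {μ : Measure (EuclideanSpace ℝ (Fin n))}
    {T : EuclideanSpace ℝ (Fin n) ≃ᵢ EuclideanSpace ℝ (Fin n)} (h : InvariantUnder μ T) :
    μ.map T = μ := by
  ext E hE
  have hm : Measurable T := T.continuous.measurable
  rw [Measure.map_apply hm hE, ← h _ (hm hE), image_preimage_eq _ T.surjective]

/-- This includes the diagonal, where both sides take the default value `0`; the logarithmic version
has to exclude it. -/
theorem kernelΦ_eq_of_dist_eq {n : ℕ} {t r : ℝ} (ht : t ≠ 0) (hr : 0 < r)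
    {x y x' y' : EuclideanSpace ℝ (Fin n)} (h : dist x' y' = r * dist x y) :
    kernelΦ t x' y' = r ^ (-t) * kernelΦ t x y := by
  rw [kernelΦ, kernelΦ, if_neg ht, if_neg ht, h, Real.mul_rpow hr.le dist_nonneg]

theorem kernelΦ_zero_eq_of_dist_eq {n : ℕ} {r : ℝ} (hr : 0 < r)
    {x y x' y' : EuclideanSpace ℝ (Fin n)} (hxy : x ≠ y) (h : dist x' y' = r * dist x y) :
    kernelΦ 0 x' y' = Real.log r + kernelΦ 0 x y := by
  rw [kernelΦ, kernelΦ, if_pos rfl, if_pos rfl, h, Real.log_mul hr.ne' (dist_pos.2 hxy).ne']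

namespace SimilarityIFS

variable {n M : ℕ} (F : SimilarityIFS n M)

/-- The similarity `s_m ∘ T ∘ s_k⁻¹`, mapping `s_k(T⁻¹ Γ)` onto `Γ_m`. -/
noncomputable def transfer (m k : List (Fin M))
    (T : EuclideanSpace ℝ (Fin n) ≃ᵢ EuclideanSpace ℝ (Fin n)) :
    EuclideanSpace ℝ (Fin n) ≃ₜ EuclideanSpace ℝ (Fin n) :=
  ((F.wordHomeo k).symm.trans T.toHomeomorph).trans (F.wordHomeo m)

namespace IsSelfSimilarMeasure

variable {F} {Γ : Set (EuclideanSpace ℝ (Fin n))} {p p' : Fin M → ℝ}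
  {μ μ' : Measure (EuclideanSpace ℝ (Fin n))}

/-- Both restrictions are weighted images of `μ` under word maps; as `s_m ∘ T ∘ s_k⁻¹ ∘ s_k = s_m ∘
T` and `T` preserves `μ`, only the weights differ. -/
theorem restrict_piece_eq_map_transfer (hμ : F.IsSelfSimilarMeasure Γ p μ)
    (hΓ : F.IsAttractor Γ) (hosc : F.OpenSetCondition) (m k : List (Fin M))
    {T : EuclideanSpace ℝ (Fin n) ≃ᵢ EuclideanSpace ℝ (Fin n)} (hT : InvariantUnder μ T) :
    μ.restrict (F.piece Γ m) = ENNReal.ofReal (wordWeight p m / wordWeight p k) •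
      (μ.restrict (F.piece Γ k)).map (F.transfer m k T) := by
  have hm := wordWeight_pos hμ.weight_pos m
  have hk := wordWeight_pos hμ.weight_pos k
  rw [hμ.restrict_piece hΓ hosc, hμ.restrict_piece hΓ hosc, Measure.map_smul, smul_smul,
    ← ENNReal.ofReal_mul (by positivity), div_mul_cancel₀ _ hk.ne',
    Measure.map_map (F.transfer m k T).continuous.measurable
      (F.measurable_word k)]
  have : ⇑(F.transfer m k T) ∘ ⇑(F.word k) = F.word m ∘ T := by
    funext x
    change F.word m (T ((F.word k).symm (F.word k x))) = _
    rw [Equiv.symm_apply_apply]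
    rfl
  rw [this, ← Measure.map_map (F.measurable_word m) T.continuous.measurable,
    hT.map_eq]

/-- Evaluates the integral of the constant `log r` in the case `t = 0`. -/
theorem measureReal_piece (hμ : F.IsSelfSimilarMeasure Γ p μ)
    (hΓ : F.IsAttractor Γ) (hosc : F.OpenSetCondition) (m : List (Fin M)) :
    μ.real (F.piece Γ m) = wordWeight p m * μ.real Γ := by
  have h := congrArg (fun ν : Measure _ => ν univ) (hμ.restrict_piece hΓ hosc m)
  simp only [Measure.restrict_apply_univ, Measure.smul_apply, smul_eq_mul] at h
  rw [Measure.map_apply (F.measurable_word m) .univ, preimage_univ,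
    ← measure_add_measure_compl hΓ.isCompact.measurableSet, hμ.supported, add_zero] at h
  rw [Measure.real, h, ENNReal.toReal_mul,
    ENNReal.toReal_ofReal (wordWeight_pos hμ.weight_pos m).le, Measure.real]

theorem subIntegral_eq_transfer (hμ : F.IsSelfSimilarMeasure Γ p μ)
    (hμ' : F.IsSelfSimilarMeasure Γ p' μ') (hΓ : F.IsAttractor Γ) (hosc : F.OpenSetCondition)
    (m m' k k' : List (Fin M)) {T T' : EuclideanSpace ℝ (Fin n) ≃ᵢ EuclideanSpace ℝ (Fin n)}
    (hT : InvariantUnder μ T) (hT' : InvariantUnder μ' T') (t : ℝ) :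
    F.subIntegral Γ μ μ' t m m' =
      (wordWeight p m * wordWeight p' m') / (wordWeight p k * wordWeight p' k') *
        ∫ x in F.piece Γ k, ∫ y in F.piece Γ k',
          kernelΦ t (F.transfer m k T x) (F.transfer m' k' T' y) ∂μ' ∂μ := by
  have h0 := (wordWeight_pos hμ.weight_pos m).le
  have h1 := (wordWeight_pos hμ'.weight_pos m').le
  have h2 := (wordWeight_pos hμ.weight_pos k).le
  have h3 := (wordWeight_pos hμ'.weight_pos k').le
  rw [subIntegral, hμ.restrict_piece_eq_map_transfer hΓ hosc m k hT,
    hμ'.restrict_piece_eq_map_transfer hΓ hosc m' k' hT', integral_smul_measure,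
    (F.transfer m k T).measurableEmbedding.integral_map]
  simp_rw [integral_smul_measure, (F.transfer m' k' T').measurableEmbedding.integral_map]
  rw [integral_smul, ENNReal.toReal_ofReal (by positivity), ENNReal.toReal_ofReal (by positivity),
    smul_eq_mul, smul_eq_mul, ← mul_assoc, div_mul_div_comm]

end IsSelfSimilarMeasure

end SimilarityIFS

/-- Similarity of two sub-integrals; `k`, `k'` are the second pair of vector indices (bold `n`, `n'`)
and `r` is the scaling factor. -/
theorem proposition3p2 {n M : ℕ} (F : SimilarityIFS n M) (hosc : F.OpenSetCondition)
    (Γ : Set (EuclideanSpace ℝ (Fin n))) (hΓ : F.IsAttractor Γ)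
    (p p' : Fin M → ℝ) (μ μ' : MeasureTheory.Measure (EuclideanSpace ℝ (Fin n)))
    (hμ : F.IsSelfSimilarMeasure Γ p μ) (hμ' : F.IsSelfSimilarMeasure Γ p' μ')
    (htstar : 0 < F.tStar Γ μ μ')
    (m m' k k' : List (Fin M))
    (T T' : EuclideanSpace ℝ (Fin n) ≃ᵢ EuclideanSpace ℝ (Fin n))
    (hT : InvariantUnder μ T) (hT' : InvariantUnder μ' T')
    (r : ℝ) (hr : 0 < r)
    (hsim : ∀ x y : EuclideanSpace ℝ (Fin n),
      dist (F.word m (T ((F.word k).symm x))) (F.word m' (T' ((F.word k').symm y)))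
        = r * dist x y) :
    (∀ t : ℝ, 0 < t → ENNReal.ofReal t < F.tStar Γ μ μ' →
      F.SubIntegralConverges Γ μ μ' t m m' ∧ F.SubIntegralConverges Γ μ μ' t k k' ∧
      F.subIntegral Γ μ μ' t m m' =
        (wordWeight p m * wordWeight p' m') / (wordWeight p k * wordWeight p' k')
          * r ^ (-t) * F.subIntegral Γ μ μ' t k k') ∧
    (F.SubIntegralConverges Γ μ μ' 0 m m' ∧ F.SubIntegralConverges Γ μ μ' 0 k k' ∧
      F.subIntegral Γ μ μ' 0 m m' =
        wordWeight p m * wordWeight p' m' *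
          (μ.real Γ * μ'.real Γ * Real.log r
            + 1 / (wordWeight p k * wordWeight p' k') * F.subIntegral Γ μ μ' 0 k k')) := by
  have := hμ.isFiniteMeasure
  have := hμ'.isFiniteMeasure
  have hsim' : ∀ x y, dist (F.transfer m k T x) (F.transfer m' k' T' y) = r * dist x y := hsim
  refine ⟨fun t ht htlt => ?_, ?_⟩
  · have hconv := F.subIntegralConverges_of_lt_tStar ht.le htlt
    refine ⟨hconv.of_nil hΓ m m', hconv.of_nil hΓ k k', ?_⟩
    rw [hμ.subIntegral_eq_transfer hμ' hΓ hosc m m' k k' hT hT' t]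
    simp_rw [fun x y => kernelΦ_eq_of_dist_eq ht.ne' hr (hsim' x y), integral_const_mul]
    rw [← mul_assoc, SimilarityIFS.subIntegral]
  · have hconv := F.subIntegralConverges_of_lt_tStar le_rfl (by simpa using htstar)
    have hk := hconv.of_nil hΓ k k'
    refine ⟨hconv.of_nil hΓ m m', hk, ?_⟩
    have hpk := (wordWeight_pos hμ.weight_pos k).ne'
    have hpk' := (wordWeight_pos hμ'.weight_pos k').ne'
    have hint : Integrable (fun z : EuclideanSpace ℝ (Fin n) × EuclideanSpace ℝ (Fin n) =>
        kernelΦ 0 z.1 z.2) ((μ.restrict (F.piece Γ k)).prod (μ'.restrict (F.piece Γ k'))) := by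
      rw [Measure.prod_restrict]
      exact hk.2
    -- With `Real.log 0 = 0`, the additive scaling law fails on the diagonal when `r ≠ 1`, so
    -- nullity of the diagonal is needed.
    have hdiag : ∀ᵐ z ∂((μ.restrict (F.piece Γ k)).prod (μ'.restrict (F.piece Γ k'))),
        z.1 ≠ z.2 := by
      have hd : MeasurableSet {z : EuclideanSpace ℝ (Fin n) × EuclideanSpace ℝ (Fin n) |
          z.1 = z.2} := measurableSet_eq_fun measurable_fst measurable_snd
      rw [Measure.prod_restrict, ae_iff]
      simp only [ne_eq, not_not]
      rw [Measure.restrict_apply hd, inter_comm]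
      exact hk.1
    have hae : (fun z : EuclideanSpace ℝ (Fin n) × EuclideanSpace ℝ (Fin n) =>
        kernelΦ 0 (F.transfer m k T z.1) (F.transfer m' k' T' z.2)) =ᵐ[
          (μ.restrict (F.piece Γ k)).prod (μ'.restrict (F.piece Γ k'))]
        fun z => Real.log r + kernelΦ 0 z.1 z.2 := by
      filter_upwards [hdiag] with z hz
      exact kernelΦ_zero_eq_of_dist_eq hr hz (hsim' z.1 z.2)
    rw [hμ.subIntegral_eq_transfer hμ' hΓ hosc m m' k k' hT hT' 0,
      integral_integral (f := fun x y => kernelΦ 0 (F.transfer m k T x) (F.transfer m' k' T' y))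
        (((integrable_const _).add hint).congr hae.symm),
      integral_congr_ae hae, integral_add (integrable_const _) hint, SimilarityIFS.subIntegral,
      integral_integral (f := fun x y => kernelΦ 0 x y) hint, integral_const,
      ← univ_prod_univ, measureReal_prod_prod, measureReal_restrict_apply_univ,
      measureReal_restrict_apply_univ, hμ.measureReal_piece hΓ hosc,
      hμ'.measureReal_piece hΓ hosc, smul_eq_mul]
    field_simp
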